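/- For a function $g$ with values in $\mathbb C$ write $\|g\|_\infty:=\sup|g|$ for its uniform norm, and for $0\le\alpha\le1$ and $g:\mathbb R\to\mathbb C$ write $$\|g\|_{\Lambda_\alpha}:=\sup_{t_1\ne t_2}\frac{|g(t_1)-g(t_2)|}{|t_1-t_2|^\alpha}.$$ Let $\mathfrak A_0$ be the class of all bounded Borel functions $\phi:\mathbb R^2\to\mathbb C$ admitting a representation $$\phi(\lambda,\mu)=\int_S\alpha_s(\lambda)\,\beta_s(\mu)\,d\nu(s)\quad\text{for all }\lambda,\mu\in\mathbb R,\qquad \int_S\|\alpha_s\|_\infty\|\beta_s\|_\infty\,d\nu(s)<\infty,$$ where $(S,\nu)$ is a measure space, $\alpha_s,\beta_s:\mathbb R\to\mathbb C$ are bounded Borel functions for every $s\in S$, the functions $(s,t)\mapsto\alpha_s(t)$ and $(s,t)\mapsto\beta_s(t)$ are jointly measurable, and $s\mapsto\|\alpha_s\|_\infty\|\beta_s\|_\infty$ is $\nu$-measurable. Let $\|\phi\|_{\mathfrak A_0}$ be the infimum of $\int_S\|\alpha_s\|_\infty\|\beta_s\|_\infty\,d\nu(s)$ over all such representations. **Theorem.**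 Let $0\le\theta<1$ and $0<\epsilon\le1$. There is a constant $c=c(\epsilon,\theta)>0$ such that for every differentiable function $f:\mathbb R\to\mathbb C$ with $\|f\|_{\Lambda_\theta}<\infty$, $\|f'\|_\infty<\infty$ and $\|f'\|_{\Lambda_\epsilon}<\infty$, the divided difference $$\psi_f(\lambda,\mu)=\frac{f(\lambda)-f(\mu)}{\lambda-\mu}\ \ (\lambda\ne\mu),\qquad \psi_f(\lambda,\lambda)=f'(\lambda),$$ belongs to $\mathfrak A_0$, and $$\|\psi_f\|_{\mathfrak A_0}\le c\,\bigl(\|f\|_{\Lambda_\theta}+\|f'\|_\infty+\|f'\|_{\Lambda_\epsilon}\bigr).$$ -/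

import Mathlib

open MeasureTheory
open scoped ENNReal NNReal

/-- The uniform norm `sup_x |g x|` of a function, with value `∞` if `g` is unbounded. -/
noncomputable def uniformNorm {X : Type*} (g : X → ℂ) : ℝ≥0∞ := ⨆ x, ‖g x‖ₑ

/-- The divided difference of a function `f : ℝ → ℂ`, with value `f' t` on the diagonal. -/
noncomputable def dividedDifference (f : ℝ → ℂ) (p : ℝ × ℝ) : ℂ :=
  if p.1 = p.2 then deriv f p.1 else (f p.1 - f p.2) / ((p.1 - p.2 : ℝ) : ℂ)

/-- The cost `∫_S ‖α_s‖_∞ ‖β_s‖_∞ dν(s)` of two families of functions over `(S, ν)`. -/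
noncomputable def repCost {S : Type} [MeasurableSpace S] (ν : Measure S) (α β : S → ℝ → ℂ) :
    ℝ≥0∞ :=
  ∫⁻ s, uniformNorm (α s) * uniformNorm (β s) ∂ν

/-- `φ(x, y) = ∫_S α_s(x) β_s(y) dν(s)` for all `x, y`, where `α_s`, `β_s` are bounded Borel
functions depending measurably on `s` and `∫_S ‖α_s‖_∞ ‖β_s‖_∞ dν(s) < ∞`. The integral over `S`
in `eq_integral` converges absolutely because of the other fields. Joint measurability gives in
particular that each `α_s` and `β_s` is Borel; the measurability of `s ↦ ‖α_s‖_∞ ‖β_s‖_∞`, needed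
for its integral to make sense, is not automatic for suprema over uncountable sets. -/
structure IsIntegralRep {S : Type} [MeasurableSpace S] (ν : Measure S) (α β : S → ℝ → ℂ)
    (φ : ℝ × ℝ → ℂ) : Prop where
  measurable_left : Measurable (fun p : S × ℝ => α p.1 p.2)
  measurable_right : Measurable (fun p : S × ℝ => β p.1 p.2)
  bounded_left : ∀ s, uniformNorm (α s) < ∞
  bounded_right : ∀ s, uniformNorm (β s) < ∞
  aemeasurable_norm : AEMeasurable (fun s => uniformNorm (α s) * uniformNorm (β s)) ν
  cost_lt_top : repCost ν α β < ∞
  eq_integral : ∀ x y : ℝ, φ (x, y) = ∫ s, α s x * β s y ∂ν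

/-- The class `𝔄₀`: bounded Borel functions on the plane that admit an integral representation. -/
def MemA0 (φ : ℝ × ℝ → ℂ) : Prop :=
  Measurable φ ∧ uniformNorm φ < ∞ ∧
    ∃ (S : Type) (_ : MeasurableSpace S) (ν : Measure S) (α β : S → ℝ → ℂ),
      IsIntegralRep ν α β φ

/-- The norm of `𝔄₀`: the infimum of the costs of all integral representations. -/
noncomputable def a0Norm (φ : ℝ × ℝ → ℂ) : ℝ≥0∞ :=
  ⨅ (S : Type) (_ : MeasurableSpace S) (ν : Measure S) (α : S → ℝ → ℂ) (β : S → ℝ → ℂ)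
    (_ : IsIntegralRep ν α β φ), repCost ν α β

open Set Filter Topology

/-! The divided difference is cut into dyadic pieces according to the distance to the diagonal. At
scale `1 / T` a piece lives on the bands `⌊T * x⌋ = ⌊T * y⌋ + j` with `|j|` equal to `2` or `3`. The
indicator of such a band costs `1` (`ite_eq`), and `1 / (x - y)` on it costs at most `T`
(`ite_inv_sub`).

On a band, a corner `c = ⌊T * y⌋ / T` is a function of `x` alone as well as of `y` alone, so `f x -
f y = (f x - f c) - (f y - f c)` separates the variables into terms of size `M T^(-θ)`. A far piece
thus costs a multiple of `M T^(1-θ)`, summable over `T = 2^(-n)` because `θ < 1`. Near the diagonal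
`deriv f y` is subtracted first; replacing `f` by its Taylor remainder at `c`, of size `M T^(-1-ε)`,
gives the cost `M T^(-ε)`, summable over `T = 2^n` because `ε > 0`. The subtracted term depends on
`y` only and is bounded.

All this takes place in `UnitBallRep`, which is stable under products and summable series;
`exists_isIntegralRep` then supplies the measurability of the sup norms. -/

/-- `φ(x, y) = ∫ α_s(x) β_s(y) dν(s)` with jointly measurable `α`, `β` bounded by `1` and
`ν` of total mass at most `C`. -/
def UnitBallRep (C : ℝ≥0) (φ : ℝ → ℝ → ℂ) : Prop :=
  ∃ (S : Type) (_ : MeasurableSpace S) (ν : Measure S) (α β : S → ℝ → ℂ),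
    ν univ ≤ C ∧ Measurable (fun p : S × ℝ => α p.1 p.2) ∧
    Measurable (fun p : S × ℝ => β p.1 p.2) ∧ (∀ s x, ‖α s x‖ ≤ 1) ∧ (∀ s x, ‖β s x‖ ≤ 1) ∧
    ∀ x y, φ x y = ∫ s, α s x * β s y ∂ν

/-- Each inclusion of a summand is a measurable embedding, so a preimage is a countable union of
measurable images. It gives joint measurability on the disjoint unions used for series. -/
theorem Measurable.of_comp_sigma_mk_prod {ι X Y : Type*} {T : ι → Type*} [Countable ι]
    [∀ i, MeasurableSpace (T i)] [MeasurableSpace X] [MeasurableSpace Y]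
    {f : (Σ i, T i) × X → Y} (hf : ∀ i, Measurable fun p : T i × X => f (⟨i, p.1⟩, p.2)) :
    Measurable f := by
  have hmk (i : ι) : MeasurableEmbedding (Sigma.mk i : T i → Σ i, T i) := by
    refine ⟨sigma_mk_injective, ?_, ?_⟩
    · exact fun A hA => (MeasurableSpace.measurableSet_iInf.1 hA) i
    · intro A hA
      refine MeasurableSpace.measurableSet_iInf.2 fun k => ?_
      change MeasurableSet (Sigma.mk k ⁻¹' (Sigma.mk i '' A))
      by_cases h : k = i
      · subst h
        rwa [preimage_image_eq _ sigma_mk_injective]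
      · convert MeasurableSet.empty
        ext t
        simp only [mem_preimage, mem_image, mem_empty_iff_false, iff_false]
        rintro ⟨a, -, ha⟩
        exact h (congrArg Sigma.fst ha).symm
  intro s hs
  have : f ⁻¹' s = ⋃ i, Prod.map (Sigma.mk i) id ''
      ((fun p : T i × X => f (⟨i, p.1⟩, p.2)) ⁻¹' s) := by
    ext ⟨⟨i, t⟩, x⟩
    simp only [mem_preimage, mem_iUnion, mem_image, Prod.exists, Prod.map_apply, id,
      Prod.mk.injEq]
    constructor
    · exact fun h => ⟨i, t, x, h, rfl, rfl⟩
    · rintro ⟨k, a, b, h, h1, rfl⟩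
      rwa [h1] at h
  rw [this]
  exact MeasurableSet.iUnion fun i =>
    ((hmk i).prodMap MeasurableEmbedding.id).measurableSet_image.2 (hf i hs)

/-! ### Calculus of representations: products, sums, series -/

namespace UnitBallRep

variable {C D : ℝ≥0} {φ ψ : ℝ → ℝ → ℂ}

theorem mono (h : UnitBallRep C φ) (hCD : C ≤ D) : UnitBallRep D φ := by
  obtain ⟨S, _, ν, α, β, h1, h2⟩ := h
  exact ⟨S, _, ν, α, β, h1.trans (by exact_mod_cast hCD), h2⟩

theorem congr (h : UnitBallRep C φ) (hφ : ∀ x y, ψ x y = φ x y) : UnitBallRep C ψ := by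
  have : ψ = φ := by ext x y; exact hφ x y
  rwa [this]

theorem mul (h : UnitBallRep C φ) (h' : UnitBallRep D ψ) :
    UnitBallRep (C * D) (fun x y => φ x y * ψ x y) := by
  obtain ⟨S, _, ν, α, β, h1, h2, h3, h4, h5, h6⟩ := h
  obtain ⟨S', _, ν', α', β', h1', h2', h3', h4', h5', h6'⟩ := h'
  have : IsFiniteMeasure ν := ⟨h1.trans_lt ENNReal.coe_lt_top⟩
  have : IsFiniteMeasure ν' := ⟨h1'.trans_lt ENNReal.coe_lt_top⟩
  refine ⟨S × S', inferInstance, ν.prod ν', fun p x => α p.1 x * α' p.2 x,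
    fun p x => β p.1 x * β' p.2 x, ?_, ?_, ?_, ?_, ?_, ?_⟩
  · rw [← univ_prod_univ, Measure.prod_prod, ENNReal.coe_mul]
    gcongr
  · exact (h2.comp (by fun_prop : Measurable fun p : (S × S') × ℝ => (p.1.1, p.2))).mul
      (h2'.comp (by fun_prop : Measurable fun p : (S × S') × ℝ => (p.1.2, p.2)))
  · exact (h3.comp (by fun_prop : Measurable fun p : (S × S') × ℝ => (p.1.1, p.2))).mul
      (h3'.comp (by fun_prop : Measurable fun p : (S × S') × ℝ => (p.1.2, p.2)))
  · intro s x
    rw [norm_mul]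
    exact mul_le_one₀ (h4 _ _) (norm_nonneg _) (h4' _ _)
  · intro s x
    rw [norm_mul]
    exact mul_le_one₀ (h5 _ _) (norm_nonneg _) (h5' _ _)
  · intro x y
    simp only [h6, h6']
    rw [← integral_prod_mul]
    congr 1
    ext p
    ring

theorem of_left {A : ℝ → ℂ} (hA : Measurable A) (hC : ∀ x, ‖A x‖ ≤ C) :
    UnitBallRep C (fun x _ => A x) := by
  refine ⟨Unit, inferInstance, C • Measure.dirac (), fun _ x => A x / C, fun _ _ => 1,
    ?_, by fun_prop, by fun_prop, ?_, by simp, ?_⟩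
  · simp
  · intro _ x
    rw [norm_div, Complex.norm_real, NNReal.norm_eq]
    exact div_le_one_of_le₀ (hC x) C.2
  · intro x y
    rw [integral_smul_nnreal_measure, integral_dirac]
    -- For `C = 0` the quotient `A x / C` is `0` by convention, which agrees with `A x = 0`.
    rcases eq_or_ne C 0 with rfl | h
    · have := hC x
      simp at this
      simp [this]
    · have h' : ((C : ℝ) : ℂ) ≠ 0 := by exact_mod_cast h
      rw [NNReal.smul_def, Complex.real_smul]
      field_simp

theorem of_right {B : ℝ → ℂ} (hB : Measurable B) (hC : ∀ x, ‖B x‖ ≤ C) :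
    UnitBallRep C (fun _ y => B y) := by
  obtain ⟨S, _, ν, α, β, h1, h2, h3, h4, h5, h6⟩ := of_left hB hC
  exact ⟨S, _, ν, β, α, h1, h3, h2, h5, h4, fun x y => by
    rw [h6 y x]; simp only [mul_comm]⟩

theorem const (c : ℂ) : UnitBallRep ‖c‖₊ (fun _ _ => c) :=
  of_left measurable_const fun _ => le_rfl

theorem norm_le (h : UnitBallRep C φ) (x y : ℝ) : ‖φ x y‖ ≤ C := by
  obtain ⟨S, _, ν, α, β, h1, h2, h3, h4, h5, h6⟩ := h
  have : IsFiniteMeasure ν := ⟨h1.trans_lt ENNReal.coe_lt_top⟩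
  rw [h6]
  refine (norm_integral_le_of_norm_le_const (C := 1) (ae_of_all _ fun s => ?_)).trans ?_
  · rw [norm_mul]
    exact mul_le_one₀ (h4 _ _) (norm_nonneg _) (h5 _ _)
  · rw [one_mul]
    exact ENNReal.toReal_le_coe_of_le_coe h1

/-- The parameter space is the disjoint union of the given ones, so the masses add up. -/
theorem hasSum {ι : Type} [Countable ι] {C : ι → ℝ≥0} {φ : ι → ℝ → ℝ → ℂ}
    (h : ∀ i, UnitBallRep (C i) (φ i)) {D : ℝ≥0} (hD : HasSum C D) :
    UnitBallRep D (fun x y => ∑' i, φ i x y) := by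
  choose S mS ν α β h1 h2 h3 h4 h5 h6 using h
  have hmk (i : ι) : Measurable (Sigma.mk i : S i → Σ i, S i) :=
    fun A hA => (MeasurableSpace.measurableSet_iInf.1 hA) i
  set μ : Measure (Σ i, S i) := Measure.sum fun i => (ν i).map (Sigma.mk i)
  have hμ : μ univ ≤ D := by
    rw [Measure.sum_apply _ MeasurableSet.univ, ← hD.tsum_eq, ENNReal.coe_tsum hD.summable]
    refine ENNReal.tsum_le_tsum fun i => ?_
    rw [Measure.map_apply (hmk i) MeasurableSet.univ]
    exact h1 i
  have : IsFiniteMeasure μ := ⟨hμ.trans_lt ENNReal.coe_lt_top⟩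
  have hα : Measurable fun p : (Σ i, S i) × ℝ => α p.1.1 p.1.2 p.2 :=
    Measurable.of_comp_sigma_mk_prod h2
  have hβ : Measurable fun p : (Σ i, S i) × ℝ => β p.1.1 p.1.2 p.2 :=
    Measurable.of_comp_sigma_mk_prod h3
  refine ⟨Σ i, S i, inferInstance, μ, fun s x => α s.1 s.2 x, fun s x => β s.1 s.2 x, hμ,
    hα, hβ, fun s x => h4 _ _ _, fun s x => h5 _ _ _, fun x y => ?_⟩
  have hm : Measurable fun s : Σ i, S i => α s.1 s.2 x * β s.1 s.2 y :=
    (hα.comp (measurable_id.prodMk measurable_const)).mul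
      (hβ.comp (measurable_id.prodMk measurable_const))
  have hi : Integrable (fun s : Σ i, S i => α s.1 s.2 x * β s.1 s.2 y) μ := by
    refine Integrable.of_bound hm.aestronglyMeasurable 1 (ae_of_all _ fun s => ?_)
    rw [norm_mul]
    exact mul_le_one₀ (h4 _ _ _) (norm_nonneg _) (h5 _ _ _)
  rw [← (hasSum_integral_measure hi).tsum_eq]
  refine tsum_congr fun i => ?_
  rw [integral_map (hmk i).aemeasurable hm.aestronglyMeasurable, h6]

theorem sum {ι : Type} (s : Finset ι) {C : ι → ℝ≥0} {φ : ι → ℝ → ℝ → ℂ}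
    (h : ∀ i ∈ s, UnitBallRep (C i) (φ i)) :
    UnitBallRep (∑ i ∈ s, C i) (fun x y => ∑ i ∈ s, φ i x y) := by
  refine (hasSum (ι := s) (C := fun i => C i) (φ := fun i => φ i) (fun i => h i i.2)
    (hasSum_fintype _)).congr (fun x y => ?_) |>.mono ?_
  · rw [tsum_fintype, Finset.sum_coe_sort s (fun i => φ i x y)]
  · rw [Finset.sum_coe_sort s C]

theorem add (h : UnitBallRep C φ) (h' : UnitBallRep D ψ) :
    UnitBallRep (C + D) (fun x y => φ x y + ψ x y) := by
  refine ((sum (Finset.univ : Finset Bool) (C := fun b => cond b C D)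
    (φ := fun b => cond b φ ψ) ?_).congr ?_).mono ?_
  · rintro (_ | _) _
    exacts [h', h]
  · simp
  · simp

theorem pow (h : UnitBallRep C φ) (n : ℕ) : UnitBallRep (C ^ n) (fun x y => φ x y ^ n) := by
  induction n with
  | zero => simpa using const 1
  | succ n ih => simpa only [pow_succ] using ih.mul h

/-- The costs dominate the terms, so the series converges absolutely and its sum is the limit of the
partial sums. This form suits telescoping sums. -/
theorem tendsto {C : ℕ → ℝ≥0} {φ : ℕ → ℝ → ℝ → ℂ} (h : ∀ n, UnitBallRep (C n) (φ n))
    {D : ℝ≥0} (hD : HasSum C D)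
    (hψ : ∀ x y, Tendsto (fun N => ∑ n ∈ Finset.range N, φ n x y) atTop (𝓝 (ψ x y))) :
    UnitBallRep D ψ := by
  refine (hasSum h hD).congr fun x y => ?_
  have hs : Summable fun n => φ n x y :=
    Summable.of_norm_bounded (g := fun n => (C n : ℝ)) (by exact_mod_cast hD.summable)
      fun n => (h n).norm_le x y
  exact tendsto_nhds_unique (hψ x y) hs.hasSum.tendsto_sum_nat

/-! ### Indicators and the kernel `1 / (x - y)` on bands -/

/-- Orthogonality of characters: the integral of `exp (2πi (p x - q y) s)` over `0 < s ≤ 1` is the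
indicator, and the exponential factors. -/
theorem ite_eq {p q : ℝ → ℤ} (hp : Measurable p) (hq : Measurable q) :
    UnitBallRep 1 (fun x y => if p x = q y then 1 else 0) := by
  refine ⟨ℝ, inferInstance, volume.restrict (Ioc 0 1),
    fun s x => Complex.exp ((2 * Real.pi * p x * s : ℝ) * Complex.I),
    fun s y => Complex.exp ((-(2 * Real.pi * q y * s) : ℝ) * Complex.I), by simp,
    ?_, ?_, ?_, ?_, ?_⟩
  · have : Measurable fun p' : ℝ × ℝ => ((p p'.2 : ℤ) : ℝ) :=
      (measurable_from_top (f := fun n : ℤ => (n : ℝ))).comp (hp.comp measurable_snd)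
    fun_prop
  · have : Measurable fun p' : ℝ × ℝ => ((q p'.2 : ℤ) : ℝ) :=
      (measurable_from_top (f := fun n : ℤ => (n : ℝ))).comp (hq.comp measurable_snd)
    fun_prop
  · exact fun s x => (Complex.norm_exp_ofReal_mul_I _).le
  · exact fun s x => (Complex.norm_exp_ofReal_mul_I _).le
  · intro x y
    have key (s : ℝ) : Complex.exp ((2 * Real.pi * p x * s : ℝ) * Complex.I) *
        Complex.exp ((-(2 * Real.pi * q y * s) : ℝ) * Complex.I) =
        Complex.exp (((p x - q y : ℤ) * (2 * Real.pi * Complex.I)) * s) := by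
      rw [← Complex.exp_add]
      congr 1
      push_cast
      ring
    simp_rw [key]
    rw [← intervalIntegral.integral_of_le zero_le_one]
    split_ifs with h
    · simp [h]
    · rw [integral_exp_mul_complex]
      · simp only [Complex.ofReal_one, mul_one, Complex.ofReal_zero, mul_zero,
          Complex.exp_zero, Complex.exp_int_mul_two_pi_mul_I]
        simp
      · refine mul_ne_zero ?_ Complex.two_pi_I_ne_zero
        exact_mod_cast sub_ne_zero.2 h

theorem floor_eq (t : ℝ≥0) (j : ℤ) :
    UnitBallRep 1 (fun x y => if ⌊t * x⌋ = ⌊t * y⌋ + j then 1 else 0) := by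
  have hfl (j' : ℤ) : Measurable fun x : ℝ => ⌊t * x⌋ + j' :=
    ((measurable_from_top (f := fun n : ℤ => n + j')).comp
      (Int.measurable_floor.comp (measurable_const.mul measurable_id)))
  simpa using ite_eq (hfl 0) (hfl j)

/-- The kernel `1 / (x - y)` restricted to a band of squares of side `1 / T` off the diagonal. -/
theorem ite_inv_sub {T : ℝ≥0} (hT : 0 < T) {j : ℤ} (hj : 2 ≤ |j|) :
    UnitBallRep T
      (fun x y => if ⌊T * x⌋ = ⌊T * y⌋ + j then ((x - y : ℝ) : ℂ)⁻¹ else 0) := by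
  have hT' : (0 : ℝ) < T := hT
  have hj' : (2 : ℝ) ≤ |(j : ℝ)| := by exact_mod_cast hj
  have hj0 : (j : ℝ) ≠ 0 := by
    intro h; rw [h] at hj'; norm_num at hj'
  -- On the band `T (x - y) = j (1 - (u y - u x))`. Centring the fractional part at `1 / 2` gives
  -- `|u| ≤ 1 / 4`, so the geometric series for the inverse has ratio at most `1 / 2` and total cost
  -- `2`, which `|j| ≥ 2` absorbs.
  set u : ℝ → ℝ := fun x => (Int.fract (T * x) - 1 / 2) / j
  have hum : Measurable u := by fun_prop
  have hu (x : ℝ) : |u x| ≤ 1 / 4 := by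
    have h0 := Int.fract_nonneg ((T : ℝ) * x)
    have h1 := Int.fract_lt_one ((T : ℝ) * x)
    rw [abs_div, div_le_iff₀ (by linarith)]
    have : |Int.fract ((T : ℝ) * x) - 1 / 2| ≤ 1 / 2 := by
      rw [abs_le]; constructor <;> linarith
    linarith
  have hr : UnitBallRep (1 / 2) (fun x y => ((u y : ℝ) : ℂ) + ((-u x : ℝ) : ℂ)) := by
    have hy : UnitBallRep (1 / 4) (fun _ y => ((u y : ℝ) : ℂ)) :=
      of_right (by fun_prop) fun y => by
        rw [Complex.norm_real, Real.norm_eq_abs]; simpa using hu y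
    have hx : UnitBallRep (1 / 4) (fun x _ => ((-u x : ℝ) : ℂ)) :=
      of_left (by fun_prop) fun y => by
        rw [Complex.norm_real, Real.norm_eq_abs, abs_neg]; simpa using hu y
    refine (hy.add hx).mono (le_of_eq ?_)
    rw [← NNReal.coe_inj]; push_cast; norm_num
  have hgeo : UnitBallRep 2 (fun x y => ∑' n : ℕ, (((u y : ℝ) : ℂ) + ((-u x : ℝ) : ℂ)) ^ n) := by
    refine hasSum (fun n => hr.pow n) ?_
    rw [← NNReal.hasSum_coe]
    push_cast
    exact hasSum_geometric_two
  refine (((floor_eq T j).mul ((const ((T / j : ℝ) : ℂ)).mul hgeo)).congr ?_).mono ?_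
  · intro x y
    split_ifs with h
    · have hlt : ‖((u y : ℝ) : ℂ) + ((-u x : ℝ) : ℂ)‖ < 1 :=
        (hr.norm_le x y).trans_lt (by norm_num)
      rw [one_mul, tsum_geometric_of_norm_lt_one hlt, ← Complex.ofReal_add,
        ← Complex.ofReal_one, ← Complex.ofReal_sub, ← Complex.ofReal_inv, ← Complex.ofReal_inv,
        ← Complex.ofReal_mul]
      congr 1
      have hx := Int.self_sub_floor ((T : ℝ) * x)
      have hy := Int.self_sub_floor ((T : ℝ) * y)
      have hc : ((⌊(T : ℝ) * x⌋ : ℤ) : ℝ) = ⌊(T : ℝ) * y⌋ + j := by exact_mod_cast h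
      have e : 1 - (u y + -u x) = (T / j) * (x - y) := by
        simp only [u]
        rw [← hx, ← hy, hc]
        field_simp
        ring
      rw [e, mul_inv, ← mul_assoc, mul_inv_cancel₀ (by positivity), one_mul]
    · simp
  · rw [one_mul, ← NNReal.coe_le_coe]
    rw [NNReal.coe_mul, coe_nnnorm, Complex.norm_real, Real.norm_eq_abs, abs_div, abs_of_pos hT', div_mul_eq_mul_div,
      div_le_iff₀ (by linarith)]
    push_cast
    gcongr

end UnitBallRep

/-! ### Representations with measurable sup norms -/

/-- The two unimodular numbers `exp (i (arg z ± arccos |z|))`, whose average is `z`. -/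
noncomputable def unimodularPart (b : Bool) (z : ℂ) : ℂ :=
  Complex.exp ((z.arg + cond b 1 (-1) * Real.arccos ‖z‖ : ℝ) * Complex.I)

theorem norm_unimodularPart (b : Bool) (z : ℂ) : ‖unimodularPart b z‖ = 1 :=
  Complex.norm_exp_ofReal_mul_I _

theorem measurable_unimodularPart (b : Bool) : Measurable (unimodularPart b) := by
  unfold unimodularPart
  have := Real.continuous_arccos.measurable
  fun_prop

theorem unimodularPart_add {z : ℂ} (hz : ‖z‖ ≤ 1) :
    unimodularPart true z + unimodularPart false z = 2 * z := by
  simp only [unimodularPart, cond_true, cond_false]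
  push_cast
  rw [add_mul, add_mul, Complex.exp_add, Complex.exp_add, ← mul_add]
  have h := Complex.two_cos (Real.arccos ‖z‖)
  rw [one_mul, neg_one_mul, ← h, ← Complex.ofReal_cos,
    Real.cos_arccos (by linarith [norm_nonneg z]) hz]
  have := Complex.norm_mul_exp_arg_mul_I z
  linear_combination 2 * this

theorem uniformNorm_of_norm_eq_one {g : ℝ → ℂ} (hg : ∀ x, ‖g x‖ = 1) : uniformNorm g = 1 := by
  have (x : ℝ) : ‖g x‖ₑ = 1 := by rw [← ofReal_norm, hg, ENNReal.ofReal_one]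
  simp [uniformNorm, this]

/-- The sup norms of `α s` and `β s` need not be measurable in `s`. Writing each value as an average
of two unimodular numbers, with the choice as an extra parameter, makes all these norms equal to `1`
at unchanged total mass. -/
theorem UnitBallRep.exists_isIntegralRep {C : ℝ≥0} {φ : ℝ → ℝ → ℂ} (h : UnitBallRep C φ) :
    ∃ (S : Type) (_ : MeasurableSpace S) (ν : Measure S) (α β : S → ℝ → ℂ),
      IsIntegralRep ν α β (fun p => φ p.1 p.2) ∧ repCost ν α β ≤ C := by
  obtain ⟨S, _, ν, α, β, h1, h2, h3, h4, h5, h6⟩ := h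
  have : IsFiniteMeasure ν := ⟨h1.trans_lt ENNReal.coe_lt_top⟩
  set κ : Measure Bool := (2⁻¹ : ℝ≥0) • (Measure.dirac true + Measure.dirac false) with hκ
  have hκ1 : κ univ = 1 := by
    have : (2⁻¹ : ℝ≥0∞) + 2⁻¹ = 1 := ENNReal.inv_two_add_inv_two
    simpa [hκ, ENNReal.smul_def] using this
  have : IsFiniteMeasure κ := ⟨by rw [hκ1]; exact ENNReal.one_lt_top⟩
  have hκi {z : ℂ} (hz : ‖z‖ ≤ 1) : ∫ b, unimodularPart b z ∂κ = z := by
    rw [hκ, integral_smul_nnreal_measure, integral_add_measure (by simp) (by simp),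
      integral_dirac, integral_dirac, unimodularPart_add hz, NNReal.smul_def, Complex.real_smul]
    simp
  set μ := ν.prod (κ.prod κ)
  set α' : S × Bool × Bool → ℝ → ℂ := fun p x => unimodularPart p.2.1 (α p.1 x)
  set β' : S × Bool × Bool → ℝ → ℂ := fun p x => unimodularPart p.2.2 (β p.1 x)
  have hu : Measurable fun p : Bool × ℂ => unimodularPart p.1 p.2 :=
    measurable_from_prod_countable_right measurable_unimodularPart
  have hα' : Measurable fun p : (S × Bool × Bool) × ℝ => α' p.1 p.2 :=
    hu.comp ((by fun_prop : Measurable fun p : (S × Bool × Bool) × ℝ => p.1.2.1).prodMk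
      (h2.comp (by fun_prop : Measurable fun p : (S × Bool × Bool) × ℝ => (p.1.1, p.2))))
  have hβ' : Measurable fun p : (S × Bool × Bool) × ℝ => β' p.1 p.2 :=
    hu.comp ((by fun_prop : Measurable fun p : (S × Bool × Bool) × ℝ => p.1.2.2).prodMk
      (h3.comp (by fun_prop : Measurable fun p : (S × Bool × Bool) × ℝ => (p.1.1, p.2))))
  have hα1 (s) : uniformNorm (α' s) = 1 :=
    uniformNorm_of_norm_eq_one fun x => norm_unimodularPart _ _
  have hβ1 (s) : uniformNorm (β' s) = 1 :=
    uniformNorm_of_norm_eq_one fun x => norm_unimodularPart _ _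
  have hcost : repCost μ α' β' ≤ C := by
    simp only [repCost, hα1, hβ1, mul_one, lintegral_one]
    rw [← univ_prod_univ, Measure.prod_prod, ← univ_prod_univ, Measure.prod_prod, hκ1]
    simpa using h1
  refine ⟨S × Bool × Bool, inferInstance, μ, α', β', ⟨hα', hβ', ?_, ?_, ?_, ?_, ?_⟩, hcost⟩
  · simp [hα1]
  · simp [hβ1]
  · simp [hα1, hβ1]
  · exact hcost.trans_lt ENNReal.coe_lt_top
  · intro x y
    have hm : Measurable fun s => α' s x * β' s y :=
      (hα'.comp (measurable_id.prodMk measurable_const)).mul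
        (hβ'.comp (measurable_id.prodMk measurable_const))
    have hi : Integrable (fun s => α' s x * β' s y) μ := by
      refine Integrable.of_bound hm.aestronglyMeasurable 1 (ae_of_all _ fun s => ?_)
      simp [α', β', norm_unimodularPart]
    rw [integral_prod _ hi]
    simp only [h6]
    congr 1
    ext s
    simp only [α', β']
    rw [integral_prod_mul (fun b => unimodularPart b (α s x))
      (fun b => unimodularPart b (β s y)), hκi (h4 s x), hκi (h5 s y)]

/-! ### Dyadic neighbourhoods of the diagonal -/

/-- The indicator function of the squares of side `1 / t` that meet the diagonal or one of whose
neighbours does. -/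
noncomputable def nearDiagonal (t : ℝ≥0) (x y : ℝ) : ℂ :=
  if |⌊t * x⌋ - ⌊t * y⌋| ≤ 1 then 1 else 0

theorem nearDiagonal_eq_one {t : ℝ≥0} {x y : ℝ} (h : t * |x - y| < 1) :
    nearDiagonal t x y = 1 := by
  rw [← abs_of_nonneg t.coe_nonneg, ← abs_mul, abs_lt] at h
  rw [nearDiagonal, if_pos]
  have h1 := Int.floor_le ((t : ℝ) * x)
  have h2 := Int.lt_floor_add_one ((t : ℝ) * x)
  have h3 := Int.floor_le ((t : ℝ) * y)
  have h4 := Int.lt_floor_add_one ((t : ℝ) * y)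
  have h5 : ((⌊(t : ℝ) * x⌋ - ⌊(t : ℝ) * y⌋ : ℤ) : ℝ) < (2 : ℤ) := by push_cast; linarith [h.2]
  have h6 : ((-2 : ℤ) : ℝ) < (⌊(t : ℝ) * x⌋ - ⌊(t : ℝ) * y⌋ : ℤ) := by push_cast; linarith [h.1]
  rw [Int.cast_lt] at h5 h6
  rw [abs_le]
  omega

theorem nearDiagonal_eq_zero {t : ℝ≥0} {x y : ℝ} (h : 2 ≤ t * |x - y|) :
    nearDiagonal t x y = 0 := by
  rw [nearDiagonal, if_neg]
  intro hn
  rw [abs_le] at hn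
  have h1 := Int.floor_le ((t : ℝ) * x)
  have h2 := Int.lt_floor_add_one ((t : ℝ) * x)
  have h3 := Int.floor_le ((t : ℝ) * y)
  have h4 := Int.lt_floor_add_one ((t : ℝ) * y)
  have h5 : ((⌊(t : ℝ) * x⌋ - ⌊(t : ℝ) * y⌋ : ℤ) : ℝ) ≤ (1 : ℤ) := Int.cast_le.2 hn.2
  have h6 : ((-1 : ℤ) : ℝ) ≤ (⌊(t : ℝ) * x⌋ - ⌊(t : ℝ) * y⌋ : ℤ) := Int.cast_le.2 hn.1
  push_cast at h5 h6
  rcases abs_cases (x - y) with ⟨h', -⟩ | ⟨h', -⟩ <;> rw [h'] at h <;> nlinarith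

theorem unitBallRep_nearDiagonal (t : ℝ≥0) : UnitBallRep 3 (nearDiagonal t) := by
  refine ((UnitBallRep.sum (Finset.Icc (-1) 1) fun j _ =>
    UnitBallRep.floor_eq t j).congr fun x y => ?_).mono ?_
  · have (j : ℤ) : (⌊(t : ℝ) * x⌋ = ⌊(t : ℝ) * y⌋ + j) = (⌊(t : ℝ) * x⌋ - ⌊(t : ℝ) * y⌋ = j) := by
      rw [sub_eq_iff_eq_add']
    simp only [this, Finset.sum_ite_eq, nearDiagonal, Finset.mem_Icc, abs_le]
  · simp

theorem nearDiagonal_sub {t T : ℝ≥0} (hT : T = 2 * t) (x y : ℝ) :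
    nearDiagonal t x y - nearDiagonal T x y =
      ∑ j ∈ ({-3, -2, 2, 3} : Finset ℤ),
        nearDiagonal t x y * if ⌊T * x⌋ = ⌊T * y⌋ + j then 1 else 0 := by
  -- Squares of side `1 / T` halve those of side `1 / t`: neighbours at the fine scale stay
  -- neighbours at the coarse one, and coarse neighbours differ by at most `3` fine steps.
  have key (z : ℝ) : ⌊(T : ℝ) * z⌋ = 2 * ⌊(t : ℝ) * z⌋ ∨ ⌊(T : ℝ) * z⌋ = 2 * ⌊(t : ℝ) * z⌋ + 1 := by
    have h1 := Int.floor_le ((t : ℝ) * z)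
    have h2 := Int.lt_floor_add_one ((t : ℝ) * z)
    have h3 : (T : ℝ) * z = 2 * (t * z) := by rw [hT]; push_cast; ring
    have h4 : 2 * ⌊(t : ℝ) * z⌋ ≤ ⌊(T : ℝ) * z⌋ := by
      rw [Int.le_floor, h3]; push_cast; linarith
    have h5 : ⌊(T : ℝ) * z⌋ < 2 * ⌊(t : ℝ) * z⌋ + 2 := by
      rw [Int.floor_lt, h3]; push_cast; linarith
    omega
  have hj (j : ℤ) : (⌊(T : ℝ) * x⌋ = ⌊(T : ℝ) * y⌋ + j) = (⌊(T : ℝ) * x⌋ - ⌊(T : ℝ) * y⌋ = j) := by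
    rw [sub_eq_iff_eq_add']
  simp only [hj, ← Finset.mul_sum, Finset.sum_ite_eq, nearDiagonal, Finset.mem_insert,
    Finset.mem_singleton, abs_le]
  have hx := key x
  have hy := key y
  generalize ⌊(T : ℝ) * x⌋ = a at *
  generalize ⌊(T : ℝ) * y⌋ = b at *
  generalize ⌊(t : ℝ) * x⌋ = c at *
  generalize ⌊(t : ℝ) * y⌋ = d at *
  split_ifs <;> first | omega | simp

/-- The factor `12` is four bands times the cost `3` of `nearDiagonal t`. -/
theorem UnitBallRep.nearDiagonal_sub_mul {t T C : ℝ≥0} (hT : T = 2 * t) {h : ℝ → ℝ → ℂ}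
    (hh : ∀ j : ℤ, 2 ≤ |j| → |j| ≤ 3 →
      UnitBallRep C (fun x y => if ⌊T * x⌋ = ⌊T * y⌋ + j then h x y else 0)) :
    UnitBallRep (12 * C) (fun x y => (nearDiagonal t x y - nearDiagonal T x y) * h x y) := by
  refine ((UnitBallRep.sum ({-3, -2, 2, 3} : Finset ℤ) fun j hj =>
    (unitBallRep_nearDiagonal t).mul (hh j ?_ ?_)).congr fun x y => ?_).mono ?_
  · revert j; decide
  · revert j; decide
  · rw [nearDiagonal_sub hT, Finset.sum_mul]
    refine Finset.sum_congr rfl fun j _ => ?_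
    split_ifs <;> ring
  · rw [Finset.sum_const]
    refine le_of_eq ?_
    have : ({-3, -2, 2, 3} : Finset ℤ).card = 4 := by decide
    rw [this, nsmul_eq_mul]
    push_cast
    ring

theorem UnitBallRep.band {T K K' : ℝ≥0} (hT : 0 < T) {j : ℤ} (hj : 2 ≤ |j|) {h : ℝ → ℝ → ℂ}
    {A B E : ℝ → ℂ} (hA : Measurable A) (hB : Measurable B) (hE : Measurable E)
    (hAK : ∀ x, ‖A x‖ ≤ K) (hBK : ∀ x, ‖B x‖ ≤ K) (hEK : ∀ x, ‖E x‖ ≤ K')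
    (hh : ∀ x y : ℝ, ⌊T * x⌋ = ⌊T * y⌋ + j → h x y = (A x + B y) * ((x - y : ℝ) : ℂ)⁻¹ + E y) :
    UnitBallRep ((K + K) * T + K')
      (fun x y => if ⌊T * x⌋ = ⌊T * y⌋ + j then h x y else 0) := by
  refine (((((of_left hA hAK).add (of_right hB hBK)).mul (ite_inv_sub hT hj)).add
    ((floor_eq T j).mul (of_right hE hEK))).congr fun x y => ?_).mono ?_
  · split_ifs with hxy
    · rw [hh x y hxy, one_mul]
    · simp
  · simp

/-! ### Estimates at grid points -/

theorem abs_sub_floor_sub_div_le {T : ℝ≥0} (hT : 0 < T) {j : ℤ} (hj : |j| ≤ 3) (x : ℝ) :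
    |x - (⌊T * x⌋ - j : ℤ) / T| ≤ 4 / T := by
  have hT' : (0 : ℝ) < T := hT
  have hj' : |(j : ℝ)| ≤ 3 := by exact_mod_cast hj
  rw [abs_le] at hj'
  have h1 := Int.floor_le ((T : ℝ) * x)
  have h2 := Int.lt_floor_add_one ((T : ℝ) * x)
  have : x - (⌊T * x⌋ - j : ℤ) / T = (T * x - ⌊T * x⌋ + j) / T := by
    push_cast
    field_simp
    ring
  rw [this, abs_div, abs_of_pos hT']
  gcongr
  rw [abs_le]
  constructor <;> linarith

theorem four_div_rpow_le {r : ℝ≥0} (hr : r ≤ 1) (T : ℝ≥0) :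
    (4 / T : ℝ) ^ (r : ℝ) ≤ 4 * (T : ℝ)⁻¹ ^ (r : ℝ) := by
  rw [div_eq_mul_inv, Real.mul_rpow (by norm_num) (by positivity)]
  gcongr
  calc (4 : ℝ) ^ (r : ℝ) ≤ 4 ^ (1 : ℝ) :=
        Real.rpow_le_rpow_of_exponent_le (by norm_num) (by exact_mod_cast hr)
    _ = 4 := Real.rpow_one _

theorem HolderWith.norm_sub_floor_le {g : ℝ → ℂ} {M r T : ℝ≥0} (hg : HolderWith M r g)
    (hr : r ≤ 1) (hT : 0 < T) {j : ℤ} (hj : |j| ≤ 3) (x : ℝ) :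
    ‖g x - g ((⌊T * x⌋ - j : ℤ) / T)‖ ≤ 4 * M * T⁻¹ ^ (r : ℝ) := by
  have hT' : (0 : ℝ) < T := hT
  rw [← dist_eq_norm]
  refine (hg.dist_le _ _).trans ?_
  rw [mul_comm (4 : ℝ), mul_assoc]
  gcongr
  calc dist x ((⌊T * x⌋ - j : ℤ) / T) ^ (r : ℝ) ≤ (4 / T : ℝ) ^ (r : ℝ) := by
        gcongr
        rw [Real.dist_eq]
        exact abs_sub_floor_sub_div_le hT hj x
    _ ≤ 4 * (T : ℝ)⁻¹ ^ (r : ℝ) := four_div_rpow_le hr T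

/-- Mean value inequality for `s ↦ f s - deriv f c * (s - c)`, whose derivative is `deriv f s -
deriv f c`. -/
theorem norm_sub_sub_deriv_mul_le {f : ℝ → ℂ} (hf : Differentiable ℝ f) {c x K : ℝ}
    (hK : ∀ s, |s - c| ≤ |x - c| → ‖deriv f s - deriv f c‖ ≤ K) :
    ‖f x - f c - deriv f c * ((x - c : ℝ) : ℂ)‖ ≤ K * |x - c| := by
  have hd (s : ℝ) : HasDerivAt (fun s : ℝ => f s - deriv f c * ((s - c : ℝ) : ℂ))
      (deriv f s - deriv f c) s := by
    have h1 : HasDerivAt (fun s : ℝ => ((s - c : ℝ) : ℂ)) 1 s := by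
      simpa using ((hasDerivAt_id s).sub_const c).ofReal_comp
    have h2 := (hf s).hasDerivAt.sub (h1.const_mul (deriv f c))
    rw [mul_one] at h2
    exact h2
  have := (convex_closedBall c |x - c|).norm_image_sub_le_of_norm_hasDerivWithin_le (C := K)
    (x := c) (y := x) (fun s _ => (hd s).hasDerivWithinAt)
    (fun s hs => hK s (by rwa [Metric.mem_closedBall, Real.dist_eq] at hs))
    (Metric.mem_closedBall_self (abs_nonneg _)) (by simp [Real.dist_eq])
  rw [Real.norm_eq_abs] at this
  refine le_of_eq_of_le (congrArg norm ?_) this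
  rw [sub_self, Complex.ofReal_zero]
  ring

theorem dividedDifference_of_ne {f : ℝ → ℂ} {x y : ℝ} (h : x ≠ y) :
    dividedDifference f (x, y) = (f x - f y) * ((x - y : ℝ) : ℂ)⁻¹ := by
  rw [dividedDifference, if_neg h, div_eq_mul_inv]

theorem dividedDifference_self (f : ℝ → ℂ) (x : ℝ) : dividedDifference f (x, x) = deriv f x :=
  if_pos rfl

theorem measurable_dividedDifference {f : ℝ → ℂ} (hf : Differentiable ℝ f) :
    Measurable (dividedDifference f) := by
  have h1 := hf.continuous.measurable
  have h2 := measurable_deriv f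
  unfold dividedDifference
  refine Measurable.ite (measurableSet_eq_fun measurable_fst measurable_snd) ?_ ?_ <;> fun_prop

theorem measurable_floor_sub_div (T : ℝ≥0) (j : ℤ) :
    Measurable fun x : ℝ => ((⌊T * x⌋ - j : ℤ) : ℝ) / T :=
  (measurable_from_top (f := fun n : ℤ => ((n - j : ℤ) : ℝ) / T)).comp
    (Int.measurable_floor.comp (measurable_const.mul measurable_id))

theorem ne_of_floor_eq_add {T : ℝ≥0} {j : ℤ} (hj : 2 ≤ |j|) {x y : ℝ}
    (h : ⌊T * x⌋ = ⌊T * y⌋ + j) : x ≠ y := by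
  rintro rfl
  have : j = 0 := by omega
  simp [this] at hj

/-! ### Cost of the divided difference on one band -/

theorem UnitBallRep.dividedDifference_band {f : ℝ → ℂ} {M θ T : ℝ≥0} (hf : Continuous f)
    (hfθ : HolderWith M θ f) (hθ : θ ≤ 1) (hT : 0 < T) {j : ℤ} (hj : 2 ≤ |j|) (hj' : |j| ≤ 3) :
    UnitBallRep (8 * M * (T⁻¹ ^ (θ : ℝ) * T))
      (fun x y => if ⌊T * x⌋ = ⌊T * y⌋ + j then dividedDifference f (x, y) else 0) := by
  have hfm := hf.measurable
  have hc := measurable_floor_sub_div T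
  -- On the band `(⌊T * x⌋ - j) / T = ⌊T * y⌋ / T`, so the values of `f` subtracted in `A` and `B`
  -- cancel.
  refine (band (K := 4 * M * T⁻¹ ^ (θ : ℝ)) (K' := 0) hT hj
    (A := fun x => f x - f ((⌊T * x⌋ - j : ℤ) / T))
    (B := fun y => -(f y - f ((⌊T * y⌋ - 0 : ℤ) / T))) (E := fun _ => 0)
    (hfm.sub (hfm.comp (hc j))) (hfm.sub (hfm.comp (hc 0))).neg measurable_const
    (fun x => ?_) (fun y => ?_) (by simp) fun x y hxy => ?_).mono (le_of_eq ?_)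
  · exact_mod_cast hfθ.norm_sub_floor_le hθ hT hj' x
  · rw [norm_neg]
    exact_mod_cast hfθ.norm_sub_floor_le hθ hT (j := 0) (by simp) y
  · rw [dividedDifference_of_ne (ne_of_floor_eq_add hj hxy), hxy]
    simp only [add_sub_cancel_right, sub_zero]
    ring
  · ring

theorem UnitBallRep.dividedDifference_sub_deriv_band {f : ℝ → ℂ} {M ε T : ℝ≥0}
    (hf : Differentiable ℝ f) (hfε : HolderWith M ε (deriv f)) (hε : ε ≤ 1) (hT : 0 < T) {j : ℤ}
    (hj : 2 ≤ |j|) (hj' : |j| ≤ 3) :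
    UnitBallRep (36 * M * T⁻¹ ^ (ε : ℝ))
      (fun x y => if ⌊T * x⌋ = ⌊T * y⌋ + j then
        dividedDifference f (x, y) - deriv f y else 0) := by
  have hT' : (0 : ℝ) < T := hT
  have hfm := hf.continuous.measurable
  have hdm := measurable_deriv f
  have hc := measurable_floor_sub_div T
  set G : ℤ → ℝ → ℂ := fun j x => f x - f ((⌊T * x⌋ - j : ℤ) / T) -
    deriv f ((⌊T * x⌋ - j : ℤ) / T) * ((x - (⌊T * x⌋ - j : ℤ) / T : ℝ) : ℂ) with hG
  have hGm (j : ℤ) : Measurable (G j) :=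
    (hfm.sub (hfm.comp (hc j))).sub ((hdm.comp (hc j)).mul
      (Complex.measurable_ofReal.comp (measurable_id.sub (hc j))))
  have hGK {j : ℤ} (hj' : |j| ≤ 3) (x : ℝ) :
      ‖G j x‖ ≤ (16 * M * T⁻¹ ^ (ε : ℝ) * T⁻¹ : ℝ≥0) := by
    have hx := abs_sub_floor_sub_div_le hT hj' x
    have := norm_sub_sub_deriv_mul_le hf (c := (⌊T * x⌋ - j : ℤ) / T) (x := x)
      (K := 4 * M * (T : ℝ)⁻¹ ^ (ε : ℝ)) fun s hs => by
        rw [← dist_eq_norm]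
        refine (hfε.dist_le _ _).trans ?_
        rw [mul_comm (4 : ℝ), mul_assoc]
        gcongr
        calc dist s ((⌊T * x⌋ - j : ℤ) / T) ^ (ε : ℝ) ≤ (4 / T : ℝ) ^ (ε : ℝ) := by
              gcongr
              rw [Real.dist_eq]
              exact hs.trans hx
          _ ≤ 4 * (T : ℝ)⁻¹ ^ (ε : ℝ) := four_div_rpow_le hε T
    refine this.trans ?_
    calc _ ≤ 4 * M * (T : ℝ)⁻¹ ^ (ε : ℝ) * (4 / T) := by gcongr
      _ = _ := by push_cast; rw [div_eq_mul_inv]; ring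
  -- The Taylor remainders in `A` and `B` share the base point `c`; the difference of their linear
  -- parts, divided by `x - y`, is `deriv f c`, and `E` corrects it to `deriv f y`. The cost is `36
  -- = 2 * 16 + 4`.
  refine (band (K := 16 * M * T⁻¹ ^ (ε : ℝ) * T⁻¹) (K' := 4 * M * T⁻¹ ^ (ε : ℝ)) hT hj
    (A := G j) (B := fun y => -G 0 y)
    (E := fun y => -(deriv f y - deriv f ((⌊T * y⌋ - 0 : ℤ) / T)))
    (hGm j) (hGm 0).neg (hdm.sub (hdm.comp (hc 0))).neg (hGK hj')
    (fun y => ?_) (fun y => ?_) fun x y hxy => ?_).mono (le_of_eq ?_)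
  · rw [norm_neg]
    exact hGK (by simp) y
  · rw [norm_neg]
    exact_mod_cast hfε.norm_sub_floor_le hε hT (j := 0) (by simp) y
  · have hne := ne_of_floor_eq_add hj hxy
    have hne' : ((x : ℂ) - y) ≠ 0 := by
      rw [← Complex.ofReal_sub]
      exact_mod_cast sub_ne_zero.2 hne
    rw [dividedDifference_of_ne hne]
    simp only [hG, hxy, add_sub_cancel_right, sub_zero]
    push_cast
    field_simp
    ring
  · have : T⁻¹ * T = 1 := inv_mul_cancel₀ hT.ne'
    linear_combination (32 * M * T⁻¹ ^ (ε : ℝ)) * this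

/-! ### Summation over the scales -/

theorem UnitBallRep.nearDiagonal_mul_sub_deriv {f : ℝ → ℂ} {M ε : ℝ≥0}
    (hf : Differentiable ℝ f) (hfε : HolderWith M ε (deriv f)) (hε₀ : 0 < ε) (hε : ε ≤ 1) :
    UnitBallRep (432 * M * ∑' n : ℕ, ((2⁻¹ : ℝ≥0) ^ (ε : ℝ)) ^ n)
      (fun x y => nearDiagonal 1 x y * (dividedDifference f (x, y) - deriv f y)) := by
  have hr : (2⁻¹ : ℝ≥0) ^ (ε : ℝ) < 1 :=
    NNReal.rpow_lt_one (by norm_num [inv_lt_one_iff₀]) (by exact_mod_cast hε₀)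
  have hs : Summable fun n : ℕ => ((2⁻¹ : ℝ≥0) ^ (ε : ℝ)) ^ n := NNReal.summable_geometric hr
  refine tendsto (φ := fun n x y => (nearDiagonal (2 ^ n) x y - nearDiagonal (2 ^ (n + 1)) x y) *
    (dividedDifference f (x, y) - deriv f y)) (fun n => ?_) (hs.hasSum.mul_left _) fun x y => ?_
  · refine (nearDiagonal_sub_mul (pow_succ' 2 n) fun j hj hj' =>
      dividedDifference_sub_deriv_band hf hfε hε (by positivity) hj hj').mono ?_
    calc 12 * (36 * M * ((2 ^ (n + 1) : ℝ≥0)⁻¹) ^ (ε : ℝ))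
        = 432 * M * ((2⁻¹ : ℝ≥0) ^ (ε : ℝ)) ^ (n + 1) := by
          rw [← inv_pow, ← NNReal.rpow_natCast, ← NNReal.rpow_mul, mul_comm ((n + 1 : ℕ) : ℝ),
            NNReal.rpow_mul, NNReal.rpow_natCast]
          ring
      _ ≤ _ := by
          gcongr 432 * M * ?_
          exact pow_le_pow_of_le_one zero_le hr.le (Nat.le_succ n)
  · simp_rw [← Finset.sum_mul, Finset.sum_range_sub', pow_zero]
    -- On the diagonal `nearDiagonal (2 ^ N)` does not tend to `0`, but there the other factor
    -- vanishes.
    rcases eq_or_ne x y with rfl | hxy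
    · simp [dividedDifference_self]
    · have : ∀ᶠ N : ℕ in atTop, nearDiagonal (2 ^ N) x y = 0 := by
        have hxy' : 0 < |x - y| := abs_pos.2 (sub_ne_zero.2 hxy)
        filter_upwards [(tendsto_pow_atTop_atTop_of_one_lt (one_lt_two (α := ℝ))).eventually_ge_atTop
          (2 / |x - y|)] with N hN
        refine nearDiagonal_eq_zero ?_
        push_cast
        exact (div_le_iff₀ hxy').1 hN
      refine tendsto_const_nhds.congr' ?_
      filter_upwards [this] with N hN
      rw [hN, sub_zero]

theorem UnitBallRep.one_sub_nearDiagonal_mul {f : ℝ → ℂ} {M θ : ℝ≥0} (hf : Continuous f)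
    (hfθ : HolderWith M θ f) (hθ : θ < 1) :
    UnitBallRep (96 * M * ∑' n : ℕ, ((2⁻¹ : ℝ≥0) ^ (1 - θ : ℝ)) ^ n)
      (fun x y => (1 - nearDiagonal 1 x y) * dividedDifference f (x, y)) := by
  have hθ' : (0 : ℝ) < 1 - θ := sub_pos.2 (by exact_mod_cast hθ)
  have hr : (2⁻¹ : ℝ≥0) ^ (1 - θ : ℝ) < 1 :=
    NNReal.rpow_lt_one (by norm_num [inv_lt_one_iff₀]) hθ'
  have hs : Summable fun n : ℕ => ((2⁻¹ : ℝ≥0) ^ (1 - θ : ℝ)) ^ n := NNReal.summable_geometric hr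
  refine tendsto (φ := fun n x y =>
    (nearDiagonal (2⁻¹ ^ (n + 1)) x y - nearDiagonal (2⁻¹ ^ n) x y) *
    dividedDifference f (x, y)) (fun n => ?_) (hs.hasSum.mul_left _) fun x y => ?_
  · refine (nearDiagonal_sub_mul ?_ fun j hj hj' =>
      dividedDifference_band hf hfθ hθ.le (by positivity) hj hj').mono (le_of_eq ?_)
    · rw [pow_succ', ← mul_assoc, mul_inv_cancel₀ two_ne_zero, one_mul]
    · set T : ℝ≥0 := 2⁻¹ ^ n with hT
      have hT0 : T ≠ 0 := by positivity
      have : T⁻¹ ^ (θ : ℝ) * T = ((2⁻¹ : ℝ≥0) ^ (1 - θ : ℝ)) ^ n := by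
        calc T⁻¹ ^ (θ : ℝ) * T = T ^ (1 - θ : ℝ) := by
              rw [NNReal.rpow_sub hT0, NNReal.rpow_one, NNReal.inv_rpow, div_eq_mul_inv, mul_comm]
          _ = _ := by
              rw [hT, ← NNReal.rpow_natCast, ← NNReal.rpow_mul, mul_comm (n : ℝ),
                NNReal.rpow_mul, NNReal.rpow_natCast]
      rw [this]
      ring
  · simp_rw [← Finset.sum_mul, Finset.sum_range_sub (fun n => nearDiagonal (2⁻¹ ^ n) x y),
      pow_zero]
    have : ∀ᶠ N : ℕ in atTop, nearDiagonal (2⁻¹ ^ N) x y = 1 := by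
      have hlim := (tendsto_pow_atTop_nhds_zero_of_lt_one (r := (2⁻¹ : ℝ)) (by norm_num)
        (by norm_num)).mul_const |x - y|
      rw [zero_mul] at hlim
      filter_upwards [hlim.eventually_lt_const one_pos] with N hN
      refine nearDiagonal_eq_one ?_
      push_cast
      exact hN
    refine tendsto_const_nhds.congr' ?_
    filter_upwards [this] with N hN
    rw [hN]

theorem UnitBallRep.dividedDifference {θ ε : ℝ≥0} (hθ : θ < 1) (hε₀ : 0 < ε) (hε₁ : ε ≤ 1) :
    ∃ c : ℝ≥0, 0 < c ∧ ∀ (f : ℝ → ℂ) (M : ℝ≥0), Differentiable ℝ f → HolderWith M θ f →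
      (∀ x, ‖deriv f x‖ ≤ M) → HolderWith M ε (deriv f) →
        UnitBallRep (c * M) (fun x y => _root_.dividedDifference f (x, y)) := by
  refine ⟨3 + 432 * ∑' n : ℕ, ((2⁻¹ : ℝ≥0) ^ (ε : ℝ)) ^ n +
    96 * ∑' n : ℕ, ((2⁻¹ : ℝ≥0) ^ (1 - θ : ℝ)) ^ n, by positivity, ?_⟩
  intro f M hf hfθ hd hfε
  -- With `N = nearDiagonal 1` and `ψ` the divided difference, `ψ = N f'(y) + N (ψ - f'(y)) + (1 -
  -- N) ψ`.
  refine (((((unitBallRep_nearDiagonal 1).mul (of_right (measurable_deriv f) hd)).add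
    (nearDiagonal_mul_sub_deriv hf hfε hε₀ hε₁)).add
    (one_sub_nearDiagonal_mul hf.continuous hfθ hθ)).congr fun x y => ?_).mono (le_of_eq ?_)
  · ring
  · ring

theorem holderWith_toNNReal {g : ℝ → ℂ} {r : ℝ≥0} {K : ℝ≥0∞} (hK : K ≠ ∞)
    (h : eHolderNorm r g ≤ K) : HolderWith K.toNNReal r g := by
  have hg : MemHolder r g := eHolderNorm_lt_top.1 (h.trans_lt hK.lt_top)
  intro x y
  refine (hg.holderWith x y).trans ?_
  gcongr
  exact ENNReal.toNNReal_mono hK h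

theorem theorem4 (θ ε : ℝ≥0) (hθ : θ < 1) (hε₀ : 0 < ε) (hε₁ : ε ≤ 1) :
    ∃ c : ℝ≥0, 0 < c ∧ ∀ f : ℝ → ℂ, Differentiable ℝ f →
      eHolderNorm θ f < ∞ → uniformNorm (deriv f) < ∞ → eHolderNorm ε (deriv f) < ∞ →
        MemA0 (dividedDifference f) ∧
        a0Norm (dividedDifference f) ≤
          c * (eHolderNorm θ f + uniformNorm (deriv f) + eHolderNorm ε (deriv f)) := by
  obtain ⟨c, hc, h⟩ := UnitBallRep.dividedDifference hθ hε₀ hε₁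
  refine ⟨c, hc, fun f hf h1 h2 h3 => ?_⟩
  set K := eHolderNorm θ f + uniformNorm (deriv f) + eHolderNorm ε (deriv f) with hKdef
  have hK : K ≠ ∞ := (ENNReal.add_lt_top.2 ⟨ENNReal.add_lt_top.2 ⟨h1, h2⟩, h3⟩).ne
  have hd (x : ℝ) : ‖deriv f x‖ ≤ K.toNNReal := by
    have : ‖deriv f x‖ₑ ≤ K :=
      (le_iSup (fun x => ‖deriv f x‖ₑ) x).trans (le_add_self.trans le_self_add)
    rw [← ENNReal.coe_toNNReal hK] at this
    exact_mod_cast this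
  have hrep := h f K.toNNReal hf
    (holderWith_toNNReal hK (by rw [hKdef, add_assoc]; exact le_self_add)) hd
    (holderWith_toNNReal hK le_add_self)
  obtain ⟨S, _, ν, α, β, hI, hcost⟩ := hrep.exists_isIntegralRep
  refine ⟨⟨measurable_dividedDifference hf, ?_, S, _, ν, α, β, hI⟩, ?_⟩
  · refine lt_of_le_of_lt (iSup_le fun p => ?_) (ENNReal.coe_lt_top (r := c * K.toNNReal))
    exact_mod_cast hrep.norm_le p.1 p.2
  · rw [ENNReal.coe_mul, ENNReal.coe_toNNReal hK] at hcost
    refine le_trans ?_ hcost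
    unfold a0Norm
    exact iInf_le_of_le S <| iInf_le_of_le _ <| iInf_le_of_le ν <| iInf_le_of_le α <|
      iInf_le_of_le β <| iInf_le_of_le hI le_rfl
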